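/- For a finite set $P$ of points in the plane, call a subset of $P$ linearly separable if it is the intersection of $P$ with a closed half-plane. For $n\in\mathbb N$ let $g(n)$ be the maximum possible number of linearly separable subsets of $P$ that form an antichain under inclusion, where the maximum is taken over all such antichains and over all sets $P$ of $n$ points in the plane, no three of which are collinear. Then there is an absolute constant $d>0$ such that $$g(n)=\Omega\bigl(n^{2-d/\sqrt{\log n}}\bigr)\qquad(n\to\infty),$$ that is, there are constants $c>0$ and $n_0$ with $g(n)\ge c\,n^{2-d/\sqrt{\log n}}$ for all $n\ge n_0$. -/

import Mathlib

open Asymptotics Filter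

/-- The Euclidean plane. -/
abbrev Plane : Type := EuclideanSpace ℝ (Fin 2)

/-- No three distinct points of `P` are collinear. -/
def InGeneralPosition (P : Finset Plane) : Prop :=
  ∀ p ∈ P, ∀ q ∈ P, ∀ r ∈ P, p ≠ q → p ≠ r → q ≠ r → ¬ Collinear ℝ ({p, q, r} : Set Plane)

/-- A closed half-plane: `{x | ⟨a, x⟩ ≤ c}` for a nonzero vector `a` and a real number `c`. -/
def IsClosedHalfPlane (H : Set Plane) : Prop :=
  ∃ (a : Plane) (c : ℝ), a ≠ 0 ∧ H = {x : Plane | inner ℝ a x ≤ c}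

/-- The family of all linearly separable subsets of `P`, that is, the intersections of `P` with
closed half-planes. -/
def linearlySeparable (P : Finset Plane) : Set (Finset Plane) :=
  {A | ∃ H : Set Plane, IsClosedHalfPlane H ∧ (A : Set Plane) = (P : Set Plane) ∩ H}

/-- The cardinalities of the antichains, under inclusion, of linearly separable subsets of `P`,
where `P` ranges over all sets of `n` points in the plane, no three of which are collinear. -/
def antichainSizes (n : ℕ) : Set ℕ :=
  {m | ∃ P : Finset Plane, P.card = n ∧ InGeneralPosition P ∧
    ∃ F : Finset (Finset Plane), (F : Set (Finset Plane)) ⊆ linearlySeparable P ∧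
      IsAntichain (· ⊆ ·) (F : Set (Finset Plane)) ∧ F.card = m}

/-- The maximum size of an antichain of linearly separable subsets of an `n`-point set. -/
noncomputable def maxAntichain (n : ℕ) : ℕ := sSup (antichainSizes n)

theorem antichainSizes_bddAbove (n : ℕ) : BddAbove (antichainSizes n) := by
  refine ⟨2 ^ n, ?_⟩
  rintro m ⟨P, hP, -, F, hF, -, rfl⟩
  rw [← hP, ← Finset.card_powerset]
  refine Finset.card_le_card fun A hA => ?_
  obtain ⟨H, -, hH⟩ := hF hA
  rw [Finset.mem_powerset, ← Finset.coe_subset, hH]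
  exact Set.inter_subset_left

theorem antichainSizes_nonempty (n : ℕ) : (antichainSizes n).Nonempty := by
  classical
  let f : ℕ → Plane := fun i => !₂[(i : ℝ), (i : ℝ) ^ 2]
  have hf : Function.Injective f := by
    intro i j h
    have h0 := congrArg (fun v : Plane => v 0) h
    simpa [f] using h0
  refine ⟨0, (Finset.range n).image f, by simp [Finset.card_image_of_injective _ hf], ?_, ∅,
    by simp, by simp, by simp⟩
  intro p hp q hq r hr hpq hpr hqr hcol
  obtain ⟨i, -, rfl⟩ := Finset.mem_image.1 hp
  obtain ⟨j, -, rfl⟩ := Finset.mem_image.1 hq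
  obtain ⟨k, -, rfl⟩ := Finset.mem_image.1 hr
  obtain ⟨v, hv⟩ := (collinear_iff_of_mem (p₀ := f i) (by simp)).1 hcol
  obtain ⟨s, hs⟩ := hv (f j) (by simp)
  obtain ⟨t, ht⟩ := hv (f k) (by simp)
  have s0 := congrArg (fun v : Plane => v 0) hs
  have s1 := congrArg (fun v : Plane => v 1) hs
  have t0 := congrArg (fun v : Plane => v 0) ht
  have t1 := congrArg (fun v : Plane => v 1) ht
  simp [f] at s0 s1 t0 t1
  have hij : (j : ℝ) - i ≠ 0 := fun h => hpq (by rw [Nat.cast_injective (R := ℝ) (sub_eq_zero.1 h)])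
  have hik : (k : ℝ) - i ≠ 0 := fun h => hpr (by rw [Nat.cast_injective (R := ℝ) (sub_eq_zero.1 h)])
  have hjk : (k : ℝ) - j ≠ 0 := fun h => hqr (by rw [Nat.cast_injective (R := ℝ) (sub_eq_zero.1 h)])
  have key : ((j : ℝ) - i) * (k - i) * (k - j) = 0 := by
    have a0 : (j : ℝ) - i = s * v 0 := by linarith
    have a1 : (j : ℝ) ^ 2 - i ^ 2 = s * v 1 := by linarith
    have b0 : (k : ℝ) - i = t * v 0 := by linarith
    have b1 : (k : ℝ) ^ 2 - i ^ 2 = t * v 1 := by linarith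
    have e : ((j : ℝ) - i) * (k - i) * (k - j)
        = (j - i) * (k ^ 2 - i ^ 2) - (k - i) * (j ^ 2 - i ^ 2) := by ring
    rw [e, a0, a1, b0, b1]
    ring
  exact mul_ne_zero (mul_ne_zero hij hik) hjk key

/-- The supremum defining `maxAntichain n` is a maximum. -/
theorem isGreatest_maxAntichain (n : ℕ) : IsGreatest (antichainSizes n) (maxAntichain n) :=
  ⟨Nat.sSup_mem (antichainSizes_nonempty n) (antichainSizes_bddAbove n),
    fun _ hm => le_csSup (antichainSizes_bddAbove n) hm⟩

/-! By duality it suffices to find `N` lines and many points such that, for any two of the points,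
in either order, some line passes below the first and above the second. The lines become the points
of `P` and the points become half-planes. The inequalities are strict, so a small perturbation
(`card_le_maxAntichain`) gives general position.

The points form a sum of grids of sides `n t`, scaled by rapidly growing factors. Two points are
separated at the coarsest scale where they differ, by level lines of one of two integral functionals
of size `O(n t)`; at least one is positive on each relevant nonzero difference
(`exists_functionals`). Consecutive Fibonacci numbers supply functionals that, at every scale, are
positive on the one direction `(1, φ)`; this serves as the common upward direction.

A functional of scale `t` takes `O(n t * n s)` values on the grid of scale `s`, and finer scales fit
in the gaps. So `∏ n t ^ 2` points need only `2 ∑ t, ∏ s ≥ t, 32 * n t * n s` lines. Taking `n t = 2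
^ levelExponent T t` makes `n t ^ (T - t)` at most about `∏ s < t, n s`, which gives `2 ^ (2T² -
O(T))` points and `2 ^ (T² + O(T))` lines. With `T` of order `√log N`, the loss is `N ^ (O(1) / √log
N)`. -/

/-! ### Perturbation to general position, and duality. -/

/-- Moving point `i` by `s * (i, i²)` turns each degeneracy into a polynomial equation in `s`. Its
top coefficient is nonzero, being a difference of indices or a Vandermonde product, so only finitely
many `s` are bad. Repeated input points are allowed. -/
theorem exists_smul_parabola_generalPosition {n : ℕ} (X Y : Fin n → ℝ) {ε : ℝ} (hε : 0 < ε) :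
    ∃ s : ℝ, 0 < s ∧ s < ε ∧
      (∀ i j, i ≠ j → X i + s * i ≠ X j + s * j) ∧
      ∀ i j k, i ≠ j → i ≠ k → j ≠ k →
        (X j + s * j - (X i + s * i)) * (Y k + s * (k : ℝ) ^ 2 - (Y i + s * (i : ℝ) ^ 2)) -
        (X k + s * k - (X i + s * i)) * (Y j + s * (j : ℝ) ^ 2 - (Y i + s * (i : ℝ) ^ 2)) ≠ 0 := by
  have cast_ne : ∀ i j : Fin n, i ≠ j → ((j : ℕ) : ℝ) - (i : ℕ) ≠ 0 := by
    intro i j h h'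
    exact h (Fin.ext (by exact_mod_cast (sub_eq_zero.1 h').symm))
  let lin : Fin n × Fin n → Polynomial ℝ := fun p =>
    Polynomial.C (X p.2 - X p.1) + Polynomial.C (((p.2 : ℕ) : ℝ) - (p.1 : ℕ)) * Polynomial.X
  let quad : Fin n × Fin n × Fin n → Polynomial ℝ := fun p =>
    lin (p.1, p.2.1) *
      (Polynomial.C (Y p.2.2 - Y p.1) +
        Polynomial.C (((p.2.2 : ℕ) : ℝ) ^ 2 - ((p.1 : ℕ) : ℝ) ^ 2) * Polynomial.X) -
    lin (p.1, p.2.2) *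
      (Polynomial.C (Y p.2.1 - Y p.1) +
        Polynomial.C (((p.2.1 : ℕ) : ℝ) ^ 2 - ((p.1 : ℕ) : ℝ) ^ 2) * Polynomial.X)
  have lin_ne : ∀ p, p.1 ≠ p.2 → lin p ≠ 0 := by
    intro p hp h
    have := congrArg (fun f : Polynomial ℝ => f.coeff 1) h
    simp [lin] at this
    exact cast_ne _ _ hp this
  have quad_ne : ∀ p, p.1 ≠ p.2.1 → p.1 ≠ p.2.2 → p.2.1 ≠ p.2.2 → quad p ≠ 0 := by
    rintro ⟨i, j, k⟩ hij hik hjk h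
    dsimp only at hij hik hjk
    have e : ∀ t : ℝ, (quad (i, j, k)).eval t = 0 := by intro t; rw [h]; simp
    -- The second difference of the values at `-1, 0, 1` isolates the coefficient of `s²`.
    have e0 := e 0
    have e1 := e 1
    have e2 := e (-1)
    simp [quad, lin] at e0 e1 e2
    have : (((j : ℕ) : ℝ) - (i : ℕ)) * (((k : ℕ) : ℝ) - (i : ℕ)) * (((k : ℕ) : ℝ) - (j : ℕ)) = 0 := by
      linarith
    exact mul_ne_zero (mul_ne_zero (cast_ne _ _ hij) (cast_ne _ _ hik)) (cast_ne _ _ hjk) this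
  let bad : Set ℝ := (⋃ p ∈ {p : Fin n × Fin n | p.1 ≠ p.2}, {s | (lin p).IsRoot s}) ∪
    ⋃ p ∈ {p : Fin n × Fin n × Fin n | p.1 ≠ p.2.1 ∧ p.1 ≠ p.2.2 ∧ p.2.1 ≠ p.2.2},
      {s | (quad p).IsRoot s}
  have hbad : bad.Finite := by
    refine Set.Finite.union (Set.Finite.biUnion (Set.toFinite _) fun p hp => ?_)
      (Set.Finite.biUnion (Set.toFinite _) fun p hp => ?_)
    · exact Polynomial.finite_setOfPred_isRoot (lin_ne p hp)
    · exact Polynomial.finite_setOfPred_isRoot (quad_ne p hp.1 hp.2.1 hp.2.2)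
  obtain ⟨s, hs, hsb⟩ := ((Set.Ioo_infinite hε).sdiff hbad).nonempty
  refine ⟨s, hs.1, hs.2, fun i j hij h => hsb (Or.inl ?_), fun i j k hij hik hjk h => hsb (Or.inr ?_)⟩
  · refine Set.mem_biUnion (x := (i, j)) hij ?_
    simp [lin]
    linarith
  · refine Set.mem_biUnion (x := (i, j, k)) ⟨hij, hik, hjk⟩ ?_
    simp [lin, quad]
    linarith

theorem not_collinear_of_det_ne_zero {p q r : Plane}
    (h : (q 0 - p 0) * (r 1 - p 1) - (r 0 - p 0) * (q 1 - p 1) ≠ 0) :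
    ¬ Collinear ℝ ({p, q, r} : Set Plane) := by
  intro hcol
  obtain ⟨v, hv⟩ := (collinear_iff_of_mem (p₀ := p) (by simp)).1 hcol
  obtain ⟨s, hs⟩ := hv q (by simp)
  obtain ⟨t, ht⟩ := hv r (by simp)
  apply h
  rw [hs, ht]
  simp
  ring

/-- If for any two of the pairs `(x k, y k)`, read as the half-planes `v - x k * u ≤ y k`, one of
the points `(X i, Y i)` lies inside the first half-plane and outside the second, then the half-planes
give an antichain of linearly separable sets. -/
theorem card_le_maxAntichain {n : ℕ} {κ : Type*} [Fintype κ] (X Y : Fin n → ℝ) (x y : κ → ℝ)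
    (hsep : ∀ k l, k ≠ l → ∃ i, Y i - x k * X i < y k ∧ y l < Y i - x l * X i) :
    Fintype.card κ ≤ maxAntichain n := by
  classical
  have hopen : ∀ᶠ s : ℝ in nhds 0, ∀ p : κ × κ, p.1 ≠ p.2 → ∃ i : Fin n,
      (Y i + s * (i : ℝ) ^ 2) - x p.1 * (X i + s * i) < y p.1 ∧
        y p.2 < (Y i + s * (i : ℝ) ^ 2) - x p.2 * (X i + s * i) := by
    refine eventually_all.2 fun p => ?_
    by_cases hp : p.1 = p.2
    · exact Eventually.of_forall fun s h => absurd hp h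
    obtain ⟨i, h1, h2⟩ := hsep _ _ hp
    have c1 : Continuous fun s : ℝ => (Y i + s * (i : ℝ) ^ 2) - x p.1 * (X i + s * i) := by fun_prop
    have c2 : Continuous fun s : ℝ => (Y i + s * (i : ℝ) ^ 2) - x p.2 * (X i + s * i) := by fun_prop
    have e1 := (c1.tendsto 0).eventually_lt_const (u := y p.1) (by simpa using h1)
    have e2 := (c2.tendsto 0).eventually_const_lt (u := y p.2) (by simpa using h2)
    filter_upwards [e1, e2] with s a b _
    exact ⟨i, a, b⟩
  obtain ⟨ε, hε, hball⟩ := Metric.eventually_nhds_iff.1 hopen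
  obtain ⟨s, hs0, hsε, hinj, hdet⟩ := exists_smul_parabola_generalPosition X Y hε
  have hsep' := @hball s (by rw [Real.dist_eq, sub_zero, abs_of_pos hs0]; exact hsε)
  let P : Fin n → Plane := fun i => !₂[X i + s * i, Y i + s * (i : ℝ) ^ 2]
  have hP : Function.Injective P := by
    intro i j h
    by_contra hij
    have h0 := congrArg (fun v : Plane => v 0) h
    exact hinj i j hij (by simpa [P] using h0)
  let N : κ → Plane := fun k => !₂[-x k, 1]
  let A : κ → Finset Plane := fun k => (Finset.univ.image P).filter fun p => inner ℝ (N k) p ≤ y k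
  have mem_A : ∀ k i, P i ∈ A k ↔ (Y i + s * (i : ℝ) ^ 2) - x k * (X i + s * i) ≤ y k := by
    intro k i
    simp only [A, Finset.mem_filter, Finset.mem_image, Finset.mem_univ, true_and,
      exists_apply_eq_apply]
    rw [show inner ℝ (N k) (P i) = (Y i + s * (i : ℝ) ^ 2) - x k * (X i + s * i) by
      simp [N, P, PiLp.inner_apply, Fin.sum_univ_two]; ring]
  have hnot : ∀ k l, k ≠ l → ¬ A k ⊆ A l := by
    intro k l hkl hsub
    obtain ⟨i, h1, h2⟩ := hsep' (k, l) hkl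
    exact absurd ((mem_A l i).1 (hsub ((mem_A k i).2 h1.le))) (not_le.2 h2)
  have hA : Function.Injective A := by
    intro k l h
    by_contra hkl
    exact hnot k l hkl h.subset
  refine le_csSup (antichainSizes_bddAbove n) ⟨Finset.univ.image P, ?_, ?_, Finset.univ.image A,
    ?_, ?_, ?_⟩
  · rw [Finset.card_image_of_injective _ hP]; simp
  · intro p hp q hq r hr hpq hpr hqr
    obtain ⟨i, -, rfl⟩ := Finset.mem_image.1 hp
    obtain ⟨j, -, rfl⟩ := Finset.mem_image.1 hq
    obtain ⟨k, -, rfl⟩ := Finset.mem_image.1 hr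
    apply not_collinear_of_det_ne_zero
    have := hdet i j k (fun h => hpq (h ▸ rfl)) (fun h => hpr (h ▸ rfl)) (fun h => hqr (h ▸ rfl))
    simpa [P] using this
  · intro B hB
    obtain ⟨k, -, rfl⟩ := Finset.mem_image.1 hB
    refine ⟨{p | inner ℝ (N k) p ≤ y k}, ⟨N k, y k, ?_, rfl⟩, ?_⟩
    · intro h
      have := congrArg (fun v : Plane => v 1) h
      simp [N] at this
    · ext p; simp [A]
  · intro B hB C hC hBC
    obtain ⟨k, -, rfl⟩ := Finset.mem_image.1 hB
    obtain ⟨l, -, rfl⟩ := Finset.mem_image.1 hC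
    exact hnot k l fun h => hBC (h ▸ rfl)
  · rw [Finset.card_image_of_injective _ hA, Finset.card_univ]

/-! ### Integral functionals near the golden direction. -/

/-- The value at `q` of the integral linear functional with coefficients `c`. -/
def intPairing (c q : ℤ × ℤ) : ℤ := c.1 * q.1 + c.2 * q.2

theorem intPairing_add_mul (c q v : ℤ × ℤ) (l : ℤ) :
    intPairing c (q.1 + l * v.1, q.2 + l * v.2) = intPairing c q + l * intPairing c v := by
  simp only [intPairing]; ring

theorem exists_fib_even_mem_Icc {n : ℕ} (hn : 1 ≤ n) :
    ∃ g, 1 ≤ g ∧ n ≤ Nat.fib (2 * g) ∧ Nat.fib (2 * g) ≤ 3 * n := by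
  induction n, hn using Nat.le_induction with
  | base => exact ⟨1, le_rfl, by decide, by decide⟩
  | succ n hn ih =>
    obtain ⟨g, hg, h1, h2⟩ := ih
    by_cases h : n + 1 ≤ Nat.fib (2 * g)
    · exact ⟨g, hg, h, by omega⟩
    · have e1 : Nat.fib (2 * (g + 1)) = Nat.fib (2 * g) + Nat.fib (2 * g + 1) := Nat.fib_add_two
      obtain ⟨k, rfl⟩ : ∃ k, g = k + 1 := ⟨g - 1, by omega⟩
      have e2 : Nat.fib (2 * (k + 1)) = Nat.fib (2 * k) + Nat.fib (2 * k + 1) := Nat.fib_add_two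
      have e3 : Nat.fib (2 * (k + 1) + 1) = Nat.fib (2 * k + 1) + Nat.fib (2 * (k + 1)) :=
        Nat.fib_add_two
      have e4 : 0 < Nat.fib (2 * k + 1) := Nat.fib_pos.2 (by omega)
      exact ⟨k + 1 + 1, by omega, by omega, by omega⟩

theorem fib_two_mul_cassini (g : ℕ) :
    (Nat.fib (2 * g) : ℤ) * (Nat.fib (2 * g) + Nat.fib (2 * g + 1)) - Nat.fib (2 * g + 1) ^ 2
      = -1 := by
  induction g with
  | zero => simp
  | succ g ih =>
    have e1 : Nat.fib (2 * (g + 1)) = Nat.fib (2 * g) + Nat.fib (2 * g + 1) := Nat.fib_add_two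
    have e2 : Nat.fib (2 * (g + 1) + 1) = Nat.fib (2 * g + 1) + Nat.fib (2 * (g + 1)) :=
      Nat.fib_add_two
    rw [e2, e1]
    push_cast
    linear_combination ih

/-- The two functionals form a unimodular pair, so `(a, b)` is recovered from their values `v, w` by
`a = q * v + p * w` and a similar formula for `b`. If `v, w ≤ 0` are not both zero, then `a ≤ -p ≤
-n`. -/
theorem pos_or_neg_of_det_eq_neg_one {p q n a b : ℤ} (hnp : n ≤ p) (hpq : p ≤ q)
    (hdet : p * (p + q) - q ^ 2 = -1) (ha : |a| < n) (hab : a ≠ 0 ∨ b ≠ 0) :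
    0 < q * a - p * b ∨ 0 < -(p + q) * a + q * b := by
  by_contra! h
  obtain ⟨h1, h2⟩ := h
  have hn : 0 < n := (abs_nonneg a).trans_lt ha
  have ea : a = q * (q * a - p * b) + p * (-(p + q) * a + q * b) := by
    linear_combination a * hdet
  have eb : b = (p + q) * (q * a - p * b) + q * (-(p + q) * a + q * b) := by
    linear_combination b * hdet
  set v := q * a - p * b
  set w := -(p + q) * a + q * b
  have hlt := (abs_lt.1 ha).1
  have hv : v = 0 := by
    by_contra hv
    have : v ≤ -1 := by omega
    nlinarith
  have hw : w = 0 := by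
    by_contra hw
    have : w ≤ -1 := by omega
    nlinarith
  rw [hv, hw] at ea eb
  simp at ea eb
  omega

/-- The kernels of the functionals are spanned by `(p, q)` and `(q, p + q)`, with consecutive
Fibonacci numbers, so they nearly contain `(1, φ)`. The values there are `ψ ^ (2g)` and `-ψ ^
(2g+1)`; starting at an even index makes both positive. The constant 15 comes from `p + 2q ≤ 5p` and
`p ≤ 3n`. -/
theorem exists_functionals {n : ℕ} (hn : 1 ≤ n) :
    ∃ c : Bool → ℤ × ℤ, (∀ i, 0 < ((c i).1 : ℝ) + (c i).2 * Real.goldenRatio) ∧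
      (∀ i, |(c i).1| + |(c i).2| ≤ 15 * n) ∧
      ∀ d : ℤ × ℤ, |d.1| < n → d ≠ 0 → ∃ i, 0 < intPairing (c i) d := by
  obtain ⟨g, hg, h1, h2⟩ := exists_fib_even_mem_Icc hn
  have e1 : Nat.fib (2 * g + 2) = Nat.fib (2 * g) + Nat.fib (2 * g + 1) := Nat.fib_add_two
  have hpq : Nat.fib (2 * g) ≤ Nat.fib (2 * g + 1) := Nat.fib_le_fib_succ
  have hqp : Nat.fib (2 * g + 1) ≤ 2 * Nat.fib (2 * g) := by
    obtain ⟨k, rfl⟩ : ∃ k, g = k + 1 := ⟨g - 1, by omega⟩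
    have e2 : Nat.fib (2 * (k + 1)) = Nat.fib (2 * k) + Nat.fib (2 * k + 1) := Nat.fib_add_two
    have e3 : Nat.fib (2 * (k + 1) + 1) = Nat.fib (2 * k + 1) + Nat.fib (2 * (k + 1)) :=
      Nat.fib_add_two
    omega
  have f1 := Real.fib_succ_sub_goldenRatio_mul_fib (2 * g)
  have f2 := Real.fib_succ_sub_goldenRatio_mul_fib (2 * g + 1)
  have g1 : 0 < Real.goldenConj ^ (2 * g) := (even_two_mul g).pow_pos Real.goldenConj_ne_zero
  have g2 : Real.goldenConj ^ (2 * g + 1) < 0 :=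
    Odd.pow_neg (odd_two_mul_add_one g) Real.goldenConj_neg
  rw [show 2 * g + 1 + 1 = 2 * g + 2 from rfl, e1] at f2
  push_cast at f2
  have hdet := fib_two_mul_cassini g
  set p := Nat.fib (2 * g)
  set q := Nat.fib (2 * g + 1)
  refine ⟨fun i => if i then ((q : ℤ), -(p : ℤ)) else (-((p : ℤ) + q), (q : ℤ)), ?_, ?_, ?_⟩
  · rintro (_ | _)
    · simp only [Bool.false_eq_true, if_false]; push_cast; linarith
    · simp only [if_true]; push_cast; linarith
  · rintro (_ | _)
    · simp only [Bool.false_eq_true, if_false, abs_neg]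
      rw [abs_of_nonneg (by positivity), abs_of_nonneg (by positivity)]; omega
    · simp only [if_true, abs_neg, Nat.abs_cast]; omega
  · rintro ⟨a, b⟩ ha hd
    have hab : a ≠ 0 ∨ b ≠ 0 := by
      by_contra! h
      exact hd (by rw [h.1, h.2]; rfl)
    rcases pos_or_neg_of_det_eq_neg_one (p := p) (q := q) (n := n) (by exact_mod_cast h1)
      (by exact_mod_cast hpq) hdet ha hab with h | h
    · refine ⟨true, ?_⟩
      simp only [intPairing, if_true]; linarith
    · refine ⟨false, ?_⟩
      simp only [intPairing, Bool.false_eq_true, if_false]; linarith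

/-! ### The multiscale point set. -/

/-- The integral points of the box `[0, n) × [0, n)`. -/
noncomputable def intBox (n : ℕ) : Finset (ℤ × ℤ) := Finset.Ico 0 (n : ℤ) ×ˢ Finset.Ico 0 (n : ℤ)

theorem card_intBox (n : ℕ) : (intBox n).card = n ^ 2 := by
  simp [intBox, sq]

theorem card_image_intPairing_intBox_le {m n : ℕ} (hm : 1 ≤ m) (hn : 1 ≤ n) {c : ℤ × ℤ}
    (hc : |c.1| + |c.2| ≤ 15 * m) :
    ((intBox n).image (intPairing c)).card ≤ 32 * m * n := by
  have hsub : (intBox n).image (intPairing c) ⊆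
      Finset.Icc (-(15 * m * n : ℤ)) (15 * m * n) := by
    intro x hx
    obtain ⟨q, hq, rfl⟩ := Finset.mem_image.1 hx
    simp only [intBox, Finset.mem_product, Finset.mem_Ico] at hq
    obtain ⟨⟨h1, h2⟩, h3, h4⟩ := hq
    rw [Finset.mem_Icc, ← abs_le]
    calc |c.1 * q.1 + c.2 * q.2| ≤ |c.1| * |q.1| + |c.2| * |q.2| := by
          rw [← abs_mul, ← abs_mul]; exact abs_add_le _ _
      _ ≤ |c.1| * n + |c.2| * n := by
          rw [abs_of_nonneg h1, abs_of_nonneg h3]; gcongr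
      _ = (|c.1| + |c.2|) * n := by ring
      _ ≤ 15 * m * n := by gcongr
  refine (Finset.card_le_card hsub).trans ?_
  have : 1 ≤ m * n := Nat.mul_pos hm hn
  rw [Int.card_Icc, Int.toNat_le]
  push_cast
  have : (1 : ℤ) ≤ m * n := by exact_mod_cast this
  linarith

/-- A multiscale set of integral points, any two of which are separated by level lines of the
given functionals. -/
theorem exists_separated_points (n : ℕ → ℕ) (hn : ∀ t, 1 ≤ n t) (c : ℕ → Bool → ℤ × ℤ)
    (hR : ∀ t i, |(c t i).1| + |(c t i).2| ≤ 15 * n t)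
    (hc : ∀ t, ∀ d : ℤ × ℤ, |d.1| < n t → d ≠ 0 → ∃ i, 0 < intPairing (c t i) d) (T : ℕ) :
    ∃ (S : Finset (ℤ × ℤ)) (θ : ℕ → Bool → Finset ℤ),
      S.card = ∏ t ∈ Finset.range T, n t ^ 2 ∧
      (∀ t < T, ∀ i, (θ t i).card ≤ ∏ s ∈ Finset.Ico t T, 32 * n t * n s) ∧
      ∀ q ∈ S, ∀ q' ∈ S, q ≠ q' → ∃ t < T, ∃ i, ∃ x ∈ θ t i,
        intPairing (c t i) q < x ∧ x < intPairing (c t i) q' := by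
  classical
  induction T with
  | zero =>
    refine ⟨{0}, fun _ _ => ∅, by simp, by simp, ?_⟩
    intro q hq q' hq' h
    simp only [Finset.mem_singleton] at hq hq'
    exact absurd (hq.trans hq'.symm) h
  | succ T ih =>
    obtain ⟨S, θ, hS, hθ, hsep⟩ := ih
    obtain ⟨M, hM⟩ := ((S ×ˢ (Finset.univ : Finset Bool)).image
      fun p => |intPairing (c T p.2) p.1|).exists_le
    have hM' : ∀ q ∈ S, ∀ i, |intPairing (c T i) q| ≤ M := fun q hq i =>
      hM _ (Finset.mem_image.2 ⟨(q, i), by simp [hq], rfl⟩)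
    let W : ℕ → Bool → Finset ℤ := fun t i => (intBox (n T)).image (intPairing (c t i))
    have hW : ∀ t i, (W t i).card ≤ 32 * n t * n T := fun t i =>
      card_image_intPairing_intBox_le (hn t) (hn T) (hR t i)
    -- The old points have new functional values in `(-K, K)`, so after scaling the new grid by `2K`
    -- their contributions fit in the gaps.
    let K : ℤ := |M| + 1
    have hK : M < K := by have := le_abs_self M; simp only [K]; omega
    have hK0 : 0 < K := by positivity
    let F : (ℤ × ℤ) × (ℤ × ℤ) → ℤ × ℤ := fun p =>
      (p.1.1 + 2 * K * p.2.1, p.1.2 + 2 * K * p.2.2)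
    have hF : ∀ d p, intPairing d (F p) = intPairing d p.1 + 2 * K * intPairing d p.2 :=
      fun d p => intPairing_add_mul _ _ _ _
    -- Old thresholds are translated by every value on the new coarse grid, which costs a factor `32
    -- * n t * n T`. The thresholds of scale `T` lie midway between consecutive multiples of `2K`.
    let θ' : ℕ → Bool → Finset ℤ := fun t i =>
      if t < T then Finset.image₂ (fun x w => x + 2 * K * w) (θ t i) (W t i)
      else (W t i).image fun w => 2 * K * w - K
    have key : ∀ p ∈ S ×ˢ intBox (n T), ∀ p' ∈ S ×ˢ intBox (n T), p ≠ p' →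
        ∃ t < T + 1, ∃ i, ∃ x ∈ θ' t i,
          intPairing (c t i) (F p) < x ∧ x < intPairing (c t i) (F p') := by
      rintro ⟨q, v⟩ hp ⟨q', v'⟩ hp' hne
      obtain ⟨hq, hv⟩ := Finset.mem_product.1 hp
      obtain ⟨hq', hv'⟩ := Finset.mem_product.1 hp'
      dsimp only at hq hv hq' hv'
      by_cases hvv : v = v'
      · subst hvv
        obtain ⟨t, ht, i, x, hx, h1, h2⟩ := hsep q hq q' hq' fun h => hne (by rw [h])
        refine ⟨t, by omega, i, x + 2 * K * intPairing (c t i) v, ?_, ?_, ?_⟩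
        · simp only [θ', if_pos ht]
          exact Finset.mem_image₂_of_mem hx (Finset.mem_image_of_mem _ hv)
        · rw [hF]; dsimp only; omega
        · rw [hF]; dsimp only; omega
      · have hb : |(v' - v).1| < n T := by
          simp only [intBox, Finset.mem_product, Finset.mem_Ico] at hv hv'
          rw [Prod.fst_sub, abs_lt]
          omega
        obtain ⟨i, hi⟩ := hc T (v' - v) hb (sub_ne_zero.2 (Ne.symm hvv))
        have hi' : intPairing (c T i) v + 1 ≤ intPairing (c T i) v' := by
          simp only [intPairing, Prod.fst_sub, Prod.snd_sub] at hi ⊢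
          linarith
        refine ⟨T, by omega, i, 2 * K * intPairing (c T i) v' - K, ?_, ?_, ?_⟩
        · simp only [θ', lt_irrefl, if_false]
          exact Finset.mem_image_of_mem _ (Finset.mem_image_of_mem _ hv')
        · rw [hF]
          have := (abs_le.1 (hM' q hq i)).2
          dsimp only
          nlinarith
        · rw [hF]
          have := (abs_le.1 (hM' q' hq' i)).1
          dsimp only
          linarith
    have hinj : Set.InjOn F (S ×ˢ intBox (n T) : Finset ((ℤ × ℤ) × (ℤ × ℤ))) := by
      intro p hp p' hp' h
      by_contra hne
      obtain ⟨t, -, i, x, -, h1, h2⟩ := key p hp p' hp' hne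
      rw [h] at h1
      exact lt_asymm h1 h2
    refine ⟨(S ×ˢ intBox (n T)).image F, θ', ?_, ?_, ?_⟩
    · rw [Finset.card_image_of_injOn hinj, Finset.card_product, hS, card_intBox,
        Finset.prod_range_succ]
    · intro t ht i
      by_cases h : t < T
      · simp only [θ', if_pos h]
        rw [Finset.prod_Ico_succ_top h.le]
        exact (Finset.card_image₂_le _ _ _).trans (Nat.mul_le_mul (hθ t h i) (hW t i))
      · obtain rfl : t = T := by omega
        simp only [θ', lt_irrefl, if_false]
        rw [Finset.prod_Ico_succ_top le_rfl]
        simpa using Finset.card_image_le.trans (hW t i)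
    · intro q hq q' hq' hne
      obtain ⟨p, hp, rfl⟩ := Finset.mem_image.1 hq
      obtain ⟨p', hp', rfl⟩ := Finset.mem_image.1 hq'
      exact key p hp p' hp' fun h => hne (by rw [h])

/-! ### From separated points to antichains. -/

theorem Finset.exists_fin_fun_of_card_le {α : Type*} [Inhabited α] {s : Finset α} {N : ℕ}
    (h : s.card ≤ N) : ∃ f : Fin N → α, ∀ x ∈ s, ∃ i, f i = x := by
  obtain ⟨g⟩ := Function.Embedding.nonempty_of_card_le (α := s) (β := Fin N) (by simpa using h)
  exact ⟨Function.extend g Subtype.val fun _ => default,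
    fun x hx => ⟨g ⟨x, hx⟩, g.injective.extend_apply _ _ _⟩⟩

theorem prod_sq_le_maxAntichain (n : ℕ → ℕ) (hn : ∀ t, 1 ≤ n t) {T N : ℕ}
    (hN : ∑ t ∈ Finset.range T, 2 * ∏ s ∈ Finset.Ico t T, 32 * n t * n s ≤ N) :
    ∏ t ∈ Finset.range T, n t ^ 2 ≤ maxAntichain N := by
  classical
  choose c hpos hR hc using fun t => exists_functionals (hn t)
  obtain ⟨S, θ, hS, hθ, hsep⟩ := exists_separated_points n hn c hR hc T
  -- In the coordinates `x = q.2 - φ * q.1`, `y = q.1`, the direction `(1, φ)` is vertical and the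
  -- level line `c · q = θ` is `y = θ / D - (c.2 / D) * x`. Since `D > 0`, lying above it means
  -- having a larger functional value.
  let D : ℕ → Bool → ℝ := fun t i => ((c t i).1 : ℝ) + (c t i).2 * Real.goldenRatio
  let L : Finset (ℝ × ℝ) := (Finset.range T).biUnion fun t =>
    (Finset.univ : Finset Bool).biUnion fun i =>
      (θ t i).image fun x : ℤ => (((c t i).2 : ℝ) / D t i, (x : ℝ) / D t i)
  have hL : L.card ≤ N := by
    refine (Finset.card_biUnion_le.trans (Finset.sum_le_sum fun t ht => ?_)).trans hN
    refine (Finset.card_biUnion_le_card_mul _ _ _ fun i _ =>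
      Finset.card_image_le.trans (hθ t (Finset.mem_range.1 ht) i)).trans ?_
    simp
  obtain ⟨p, hp⟩ := Finset.exists_fin_fun_of_card_le hL
  rw [← hS, ← Fintype.card_coe]
  refine card_le_maxAntichain (fun i => (p i).1) (fun i => (p i).2)
    (fun q : S => (q.1.2 : ℝ) - Real.goldenRatio * q.1.1) (fun q : S => (q.1.1 : ℝ)) ?_
  intro k l hkl
  obtain ⟨t, ht, i, x, hx, h1, h2⟩ := hsep l.1 l.2 k.1 k.2 fun h => hkl (Subtype.ext h.symm)
  obtain ⟨j, hj⟩ := hp ((c t i).2 / D t i, x / D t i) (Finset.mem_biUnion.2 ⟨t,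
    Finset.mem_range.2 ht, Finset.mem_biUnion.2 ⟨i, Finset.mem_univ _,
      Finset.mem_image_of_mem _ hx⟩⟩)
  have hD : 0 < D t i := hpos t i
  have h1' : ((c t i).1 : ℝ) * l.1.1 + (c t i).2 * l.1.2 < x := by exact_mod_cast h1
  have h2' : (x : ℝ) < ((c t i).1 : ℝ) * k.1.1 + (c t i).2 * k.1.2 := by exact_mod_cast h2
  refine ⟨j, ?_, ?_⟩
  · simp only [hj]
    rw [show (x : ℝ) / D t i - (k.1.2 - Real.goldenRatio * k.1.1) * ((c t i).2 / D t i) =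
      (x - (k.1.2 - Real.goldenRatio * k.1.1) * (c t i).2) / D t i by ring, div_lt_iff₀ hD]
    simp only [D]
    linarith
  · simp only [hj]
    rw [show (x : ℝ) / D t i - (l.1.2 - Real.goldenRatio * l.1.1) * ((c t i).2 / D t i) =
      (x - (l.1.2 - Real.goldenRatio * l.1.1) * (c t i).2) / D t i by ring, lt_div_iff₀ hD]
    simp only [D]
    linarith

/-! ### Choice of the grid sizes. -/

/-- The binary logarithm of the side length of the grid used at scale `t` out of `T`. -/
def levelExponent (T t : ℕ) : ℕ := T ^ 2 / ((T - t) * (T - t + 1))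

theorem levelExponent_bounds {T t : ℕ} (ht : t < T) :
    (levelExponent T t : ℝ) ≤ (T : ℝ) ^ 2 / (T - t) - (T : ℝ) ^ 2 / (T - t + 1) ∧
      (T : ℝ) ^ 2 / (T - t) - (T : ℝ) ^ 2 / (T - t + 1) ≤ levelExponent T t + 1 := by
  have hx : (0 : ℝ) < (T : ℝ) - t := sub_pos.2 (by exact_mod_cast ht)
  have e : (T : ℝ) ^ 2 / (T - t) - (T : ℝ) ^ 2 / (T - t + 1) =
      ((T ^ 2 : ℕ) : ℝ) / (((T - t) * (T - t + 1) : ℕ) : ℝ) := by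
    push_cast [Nat.cast_sub ht.le]
    field_simp
    ring
  rw [e]
  refine ⟨Nat.cast_div_le, ?_⟩
  have h := (Nat.lt_floor_add_one (((T ^ 2 : ℕ) : ℝ) / (((T - t) * (T - t + 1) : ℕ) : ℝ))).le
  rwa [Nat.floor_div_eq_div] at h

/-- Without the floor, the exponents telescope by partial fractions; each rounding loses at most
one, hence the `t`. -/
theorem sum_levelExponent_bounds {T t : ℕ} (ht : t ≤ T) :
    ((∑ s ∈ Finset.range t, levelExponent T s : ℕ) : ℝ) ≤
        (T : ℝ) ^ 2 / (T - t + 1) - (T : ℝ) ^ 2 / (T + 1) ∧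
      (T : ℝ) ^ 2 / (T - t + 1) - (T : ℝ) ^ 2 / (T + 1) ≤
        ((∑ s ∈ Finset.range t, levelExponent T s : ℕ) : ℝ) + t := by
  induction t with
  | zero => simp
  | succ t ih =>
    obtain ⟨h1, h2⟩ := ih (by omega)
    obtain ⟨h3, h4⟩ := levelExponent_bounds (T := T) (t := t) (by omega)
    rw [Finset.sum_range_succ]
    push_cast at h1 h2 ⊢
    rw [show (T : ℝ) - (t + 1) + 1 = T - t by ring]
    constructor <;> linarith

theorem sq_div_succ_le (T : ℕ) : (T : ℝ) ^ 2 / (T + 1) ≤ T := by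
  rw [div_le_iff₀ (by positivity)]
  nlinarith [Nat.cast_nonneg (α := ℝ) T]

theorem sum_levelExponent_le (T : ℕ) : ∑ s ∈ Finset.range T, levelExponent T s ≤ T ^ 2 := by
  have h := (sum_levelExponent_bounds (le_refl T)).1
  have : (0 : ℝ) ≤ (T : ℝ) ^ 2 / (T + 1) := by positivity
  rw [sub_self, zero_add, div_one] at h
  exact_mod_cast h.trans (by linarith : (T : ℝ) ^ 2 - (T : ℝ) ^ 2 / (T + 1) ≤ (T : ℝ) ^ 2)

theorem le_sum_levelExponent (T : ℕ) :
    T ^ 2 ≤ ∑ s ∈ Finset.range T, levelExponent T s + 2 * T := by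
  have h := (sum_levelExponent_bounds (le_refl T)).2
  have h' := sq_div_succ_le T
  rw [sub_self, zero_add, div_one] at h
  have : ((T ^ 2 : ℕ) : ℝ) ≤ ((∑ s ∈ Finset.range T, levelExponent T s + 2 * T : ℕ) : ℝ) := by
    push_cast at h ⊢
    linarith
  exact_mod_cast this

/-- This is the balance behind the exponents: the factor `n t ^ (T - t)` in the line count is paid
for by the finer scales that the product over `s ≥ t` omits. One `T` in the error absorbs rounding,
the other the term `T² / (T + 1)`. -/
theorem mul_levelExponent_le {T t : ℕ} (ht : t < T) :
    (T - t) * levelExponent T t ≤ ∑ s ∈ Finset.range t, levelExponent T s + 2 * T := by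
  have hx : (0 : ℝ) < (T : ℝ) - t := sub_pos.2 (by exact_mod_cast ht)
  have h1 := (levelExponent_bounds ht).1
  have h2 := (sum_levelExponent_bounds ht.le).2
  have h3 := sq_div_succ_le T
  have h4 : (t : ℝ) ≤ T := by exact_mod_cast ht.le
  have h5 : ((T : ℝ) - t) * levelExponent T t ≤ (T : ℝ) ^ 2 / (T - t + 1) := by
    refine (mul_le_mul_of_nonneg_left h1 hx.le).trans_eq ?_
    field_simp
    ring
  have : (((T - t) * levelExponent T t : ℕ) : ℝ) ≤
      ((∑ s ∈ Finset.range t, levelExponent T s + 2 * T : ℕ) : ℝ) := by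
    push_cast [Nat.cast_sub ht.le] at h2 ⊢
    linarith
  exact_mod_cast this

theorem prod_levelExponent_le {T t : ℕ} (ht : t < T) :
    ∏ s ∈ Finset.Ico t T, 32 * 2 ^ levelExponent T t * 2 ^ levelExponent T s ≤
      2 ^ (T ^ 2 + 7 * T) := by
  have e : ∏ s ∈ Finset.Ico t T, 32 * 2 ^ levelExponent T t * 2 ^ levelExponent T s =
      2 ^ (5 * (T - t) + (T - t) * levelExponent T t +
        ∑ s ∈ Finset.Ico t T, levelExponent T s) := by
    rw [Finset.prod_mul_distrib, Finset.prod_const, Nat.card_Ico, Finset.prod_pow_eq_pow_sum,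
      mul_pow, pow_add, pow_add, pow_mul, ← pow_mul 2 (levelExponent T t),
      mul_comm (levelExponent T t)]
    norm_num
  rw [e]
  refine Nat.pow_le_pow_right two_pos ?_
  have h1 := mul_levelExponent_le ht
  have h2 := Finset.sum_range_add_sum_Ico (levelExponent T) ht.le
  have h3 := sum_levelExponent_le T
  omega

theorem two_pow_le_maxAntichain {T N : ℕ} (hN : 2 ^ (T ^ 2 + 9 * T) ≤ N) :
    2 ^ (2 * T ^ 2 - 4 * T) ≤ maxAntichain N := by
  have h := prod_sq_le_maxAntichain (fun t => 2 ^ levelExponent T t)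
    (fun t => Nat.one_le_two_pow) (T := T) (N := N) ?_
  · refine le_trans ?_ h
    simp_rw [← pow_mul]
    rw [Finset.prod_pow_eq_pow_sum, ← Finset.sum_mul]
    refine Nat.pow_le_pow_right two_pos ?_
    have := le_sum_levelExponent T
    omega
  · refine le_trans ?_ hN
    calc ∑ t ∈ Finset.range T,
          2 * ∏ s ∈ Finset.Ico t T, 32 * 2 ^ levelExponent T t * 2 ^ levelExponent T s
        ≤ ∑ t ∈ Finset.range T, 2 * 2 ^ (T ^ 2 + 7 * T) :=
          Finset.sum_le_sum fun t ht =>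
            Nat.mul_le_mul_left _ (prod_levelExponent_le (Finset.mem_range.1 ht))
      _ = 2 * T * 2 ^ (T ^ 2 + 7 * T) := by simp; ring
      _ ≤ 2 ^ (2 * T) * 2 ^ (T ^ 2 + 7 * T) := Nat.mul_le_mul_right _ Nat.lt_two_pow_self.le
      _ = 2 ^ (T ^ 2 + 9 * T) := by rw [← pow_add]; congr 1; ring

/-! ### Asymptotics for general `n`. -/

theorem rpow_le_maxAntichain {n : ℕ} (hn : 2 ^ 25 ≤ n) :
    (n : ℝ) ^ (2 - 28 / Real.sqrt (Real.log (n : ℝ))) ≤ maxAntichain n := by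
  have hn0 : n ≠ 0 := by omega
  set s := Nat.sqrt (Nat.log 2 n) with hs
  have hs5 : 5 ≤ s := Nat.le_sqrt.2 (Nat.le_log_of_pow_le (by norm_num) hn)
  -- The shift by 5 gives `T² + 9T ≤ (T + 5)² = s²`, so the construction with parameter `T` fits
  -- into `n` points.
  obtain ⟨T, hT⟩ : ∃ T, s = T + 5 := ⟨s - 5, by omega⟩
  have hle : 2 ^ (s ^ 2) ≤ n :=
    (Nat.pow_le_pow_right two_pos (Nat.sqrt_le' _)).trans (Nat.pow_log_le_self 2 hn0)
  have hlt : n < 2 ^ ((s + 1) ^ 2) :=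
    (Nat.lt_pow_succ_log_self (by norm_num) n).trans_le
      (Nat.pow_le_pow_right two_pos (Nat.lt_succ_sqrt' _))
  have hmain : 2 ^ (2 * T ^ 2 - 4 * T) ≤ maxAntichain n :=
    two_pow_le_maxAntichain ((Nat.pow_le_pow_right two_pos (by rw [hT]; nlinarith)).trans hle)
  have hnR : (0 : ℝ) < n := by positivity
  have l2 : 0 < Real.log 2 := Real.log_pos (by norm_num)
  have l2' : Real.log 2 ≤ 1 := by linarith [Real.log_two_lt_d9]
  have log_lo : (s : ℝ) ^ 2 * Real.log 2 ≤ Real.log n := by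
    have := Real.log_le_log (by positivity) (by exact_mod_cast hle : (2 : ℝ) ^ (s ^ 2) ≤ n)
    rwa [Real.log_pow, Nat.cast_pow] at this
  have log_hi : Real.log n ≤ ((s : ℝ) + 1) ^ 2 * Real.log 2 := by
    have := Real.log_le_log hnR (by exact_mod_cast hlt.le : (n : ℝ) ≤ 2 ^ ((s + 1) ^ 2))
    rw [Real.log_pow] at this
    push_cast at this
    exact this
  have hsqrt : (s : ℝ) * Real.log 2 ≤ Real.sqrt (Real.log n) := by
    refine Real.le_sqrt_of_sq_le (le_trans ?_ log_lo)
    rw [mul_pow]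
    gcongr
    nlinarith
  have hlog : 0 < Real.log n :=
    lt_of_lt_of_le (by have : (0 : ℝ) < s := by exact_mod_cast (by omega : 0 < s)
                       positivity) log_lo
  have hexp : Real.log n * (2 - 28 / Real.sqrt (Real.log n)) =
      2 * Real.log n - 28 * Real.sqrt (Real.log n) := by
    have h := Real.mul_self_sqrt hlog.le
    have h0 : Real.sqrt (Real.log n) ≠ 0 := (Real.sqrt_pos.2 hlog).ne'
    field_simp
    linarith
  have hR : ((2 : ℝ) ^ (2 * T ^ 2 - 4 * T)) ≤ maxAntichain n := by exact_mod_cast hmain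
  refine le_trans ?_ hR
  rw [Real.rpow_def_of_pos hnR, hexp, ← Real.exp_log (show (0 : ℝ) < 2 ^ (2 * T ^ 2 - 4 * T) by
    positivity), Real.exp_le_exp, Real.log_pow]
  have hsub : (2 * (T : ℝ) ^ 2 - 4 * T) ≤ ((2 * T ^ 2 - 4 * T : ℕ) : ℝ) := by
    have : 2 * T ^ 2 ≤ (2 * T ^ 2 - 4 * T) + 4 * T := by omega
    have : ((2 * T ^ 2 : ℕ) : ℝ) ≤ (((2 * T ^ 2 - 4 * T) + 4 * T : ℕ) : ℝ) := by
      exact_mod_cast this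
    push_cast at this ⊢
    linarith
  have hsT : (s : ℝ) = T + 5 := by exact_mod_cast hT
  refine le_trans ?_ (mul_le_mul_of_nonneg_right hsub l2.le)
  rw [hsT] at log_hi hsqrt
  -- In units of `log 2`, `2 * log n` is at most `2(T + 6)²`, which exceeds `2T² - 4T` by `28T +
  -- 72`; the subtracted term is at least `28(T + 5)`. This fixes the constant 28.
  nlinarith

theorem theorem1 :
    ∃ d : ℝ, 0 < d ∧
      (fun n : ℕ => (n : ℝ) ^ (2 - d / Real.sqrt (Real.log (n : ℝ))))
        =O[atTop] (fun n : ℕ => (maxAntichain n : ℝ)) := by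
  refine ⟨28, by norm_num, IsBigO.of_bound 1 ?_⟩
  filter_upwards [eventually_ge_atTop (2 ^ 25)] with n hn
  rw [one_mul, Real.norm_of_nonneg (Real.rpow_nonneg (Nat.cast_nonneg n) _),
    Real.norm_of_nonneg (Nat.cast_nonneg _)]
  exact rpow_le_maxAntichain hn
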